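/- Let $F$ be the oriented graph (an orientation of $C_4$) on four distinct vertices $x,y_1,y_2,z$ with arcs $x\to y_1$, $x\to y_2$, $y_1\to z$, $y_2\to z$. An oriented graph is a digraph without loops in which any two vertices are joined by at most one arc, and $\mathrm{ex}_o(n,F)$ denotes the largest number of arcs in an oriented graph on $n$ vertices that does not contain $F$ as a (not necessarily induced) subgraph. Then for all sufficiently large $n$, $$\mathrm{ex}_o(n,F)=\left\lfloor \frac{n^2}{4}\right\rfloor+\left\lceil \frac n2\right\rceil .$$ Moreover, for all sufficiently large $n$, this value is attained by the following construction: take a complete bipartite graph with parts of sizes $\lceil n/2\rceil$ and $\lfloor n/2\rfloor$, orient all its edges from one part to the other (in either direction), and add a directed cycle of length $\lceil n/2\rceil$ through all vertices of the part of size $\lceil n/2\rceil$. Every oriented graph obtained in this way is $F$-free and has exactly $\lfloor n^2/4\rfloor+\lceil n/2\rceil$ arcs. -/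

import Mathlib

namespace OrientedTuran

/-- A digraph is an oriented graph if it has at most one arc between any two vertices and no
loops. (Taking `u = v` in the condition excludes loops.) -/
def IsOriented {V : Type*} (G : Digraph V) : Prop :=
  ∀ u v, G.Adj u v → ¬ G.Adj v u

/-- `G` contains `F` as a (not necessarily induced) subgraph. -/
def Contains {V W : Type*} (G : Digraph V) (F : Digraph W) : Prop :=
  ∃ φ : W → V, Function.Injective φ ∧ ∀ a b, F.Adj a b → G.Adj (φ a) (φ b)

/-- `G` is `F`-free. -/
def Free {V W : Type*} (G : Digraph V) (F : Digraph W) : Prop :=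
  ¬ Contains G F

/-- The number of arcs of a finite digraph. -/
noncomputable def arcCount {V : Type*} [Fintype V] (G : Digraph V) : ℕ :=
  {p : V × V | G.Adj p.1 p.2}.ncard

open Classical in
/-- The oriented Turán number: the largest number of arcs of an `F`-free oriented graph on
`n` vertices. -/
noncomputable def exo {W : Type*} (n : ℕ) (F : Digraph W) : ℕ :=
  (Finset.univ.filter fun G : Digraph (Fin n) => IsOriented G ∧ Free G F).sup arcCount

/-- The orientation of the four-cycle with arcs `x → y₁`, `x → y₂`, `y₁ → z`, `y₂ → z`, where
`x = 0`, `y₁ = 1`, `y₂ = 2`, `z = 3`. -/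
def orientedC4 : Digraph (Fin 4) where
  Adj a b := (a = 0 ∧ b = 1) ∨ (a = 0 ∧ b = 2) ∨ (a = 1 ∧ b = 3) ∨ (a = 2 ∧ b = 3)

/-- `G` is an antidirected complete bipartite graph with parts of sizes `⌈n/2⌉` and `⌊n/2⌋`
(all arcs between the parts go in the same direction, either one), together with a directed cycle
through all the vertices of the part `A` of size `⌈n/2⌉`. The directed cycle is `v → σ v`, `v ∈ A`,
for a cyclic permutation `σ` of `A`. -/
def IsBipartiteWithCycle {n : ℕ} (G : Digraph (Fin n)) : Prop :=
  ∃ (A : Finset (Fin n)) (σ : Equiv.Perm (Fin n)),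
    A.card = (n + 1) / 2 ∧ σ.IsCycle ∧ σ.support = A ∧
    ((∀ u v, G.Adj u v ↔ (u ∈ A ∧ v ∉ A) ∨ (u ∈ A ∧ v = σ u)) ∨
     (∀ u v, G.Adj u v ↔ (u ∉ A ∧ v ∈ A) ∨ (u ∈ A ∧ v = σ u)))

end OrientedTuran

namespace OrientedTuran

/-! Being free of `orientedC4` means that a 2-path is determined by its endpoints. So the sum of
indegree times outdegree over all vertices is at most n², and when degrees are about n/2 or more,
nearly every vertex is almost a source or almost a sink. Hence all but O(n) arcs lie in a directed
cut S → T.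

Take an optimal cut with more than (n+1)²/4 arcs in total. Counting 2-paths from S to T through arcs
inside a part shows that each vertex is joined in the cut direction to almost all of the other part
(`missing_left_lt`). Then no vertex has two out-neighbours in S, since these would share an
out-neighbour in T; dually, none has two in-neighbours in T. So S and T span at most |S| and |T|
arcs. Arcs inside both parts obstruct each other: if u → s in S and t → v in T, then u → t or s → v
is missing. `not_right_heavy` shows that these losses rule out the assumed excess.

The minimum degree is secured by passing to a subset W maximising a potential (`arcs_univ_le`). For
the lower bound, the middle of any 2-path in the construction is forced by the cycle. -/

open Finset

/-! ### Degree counts and the approximate directed cut -/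

section Relation

variable {V : Type*}

open Classical in
/-- The number of out-neighbours of `v` in `A`. -/
noncomputable def outDeg (r : V → V → Prop) (A : Finset V) (v : V) : ℕ := #{w ∈ A | r v w}

open Classical in
/-- The number of in-neighbours of `v` in `A`. -/
noncomputable def inDeg (r : V → V → Prop) (A : Finset V) (v : V) : ℕ := #{w ∈ A | r w v}

open Classical in
/-- The number of vertices of `A` which are not adjacent to `v` in either direction. -/
noncomputable def nonDeg (r : V → V → Prop) (A : Finset V) (v : V) : ℕ :=
  #{w ∈ A | ¬ r v w ∧ ¬ r w v}

/-- The number of arcs from `A` to `B`. -/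
noncomputable def arcs (r : V → V → Prop) (A B : Finset V) : ℕ := ∑ v ∈ A, outDeg r B v

/-- An asymmetric relation with at most one path of length two between any two vertices. -/
structure UniqueTwoPaths (r : V → V → Prop) : Prop where
  asymm : ∀ u v, r u v → ¬ r v u
  unique : ∀ x y y' z, r x y → r x y' → r y z → r y' z → y = y'

variable {r : V → V → Prop}

lemma UniqueTwoPaths.flip (h : UniqueTwoPaths r) : UniqueTwoPaths (flip r) :=
  ⟨fun u v h1 h2 => h.asymm v u h1 h2, fun x y y' z h1 h2 h3 h4 => h.unique z y y' x h3 h4 h1 h2⟩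

lemma UniqueTwoPaths.irrefl (h : UniqueTwoPaths r) (v : V) : ¬ r v v := fun hv => h.asymm v v hv hv

lemma inDeg_flip (A : Finset V) (v : V) : inDeg (flip r) A v = outDeg r A v := rfl

lemma outDeg_flip (A : Finset V) (v : V) : outDeg (flip r) A v = inDeg r A v := rfl

lemma arcs_eq_sum_inDeg (r : V → V → Prop) (A B : Finset V) :
    arcs r A B = ∑ w ∈ B, inDeg r A w := by
  classical
  have := Finset.sum_card_bipartiteAbove_eq_sum_card_bipartiteBelow (s := A) (t := B) r
  unfold arcs outDeg inDeg
  unfold Finset.bipartiteAbove Finset.bipartiteBelow at this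
  convert this using 2

lemma arcs_flip (A B : Finset V) : arcs (flip r) B A = arcs r A B := by
  rw [arcs_eq_sum_inDeg r A B]; rfl

lemma nonDeg_flip (A : Finset V) (v : V) : nonDeg (flip r) A v = nonDeg r A v := by
  unfold nonDeg flip
  congr 1
  ext w
  simp only [Finset.mem_filter]
  tauto

open Classical in
lemma sum_nonDeg_comm (r : V → V → Prop) (A B : Finset V) (f : V → ℕ) :
    ∑ v ∈ A, nonDeg r B v * f v = ∑ w ∈ B, ∑ v ∈ A with ¬ r w v ∧ ¬ r v w, f v := by
  unfold nonDeg
  simp only [Finset.card_filter, Finset.sum_mul, Finset.sum_filter]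
  rw [Finset.sum_comm]
  refine Finset.sum_congr rfl fun w _ => Finset.sum_congr rfl fun v _ => ?_
  by_cases h : r v w <;> by_cases h' : r w v <;> simp [h, h']

lemma outDeg_union [DecidableEq V] {A B : Finset V} (h : Disjoint A B) (v : V) :
    outDeg r (A ∪ B) v = outDeg r A v + outDeg r B v := by
  classical
  unfold outDeg
  rw [Finset.filter_union, Finset.card_union_of_disjoint (Finset.disjoint_filter_filter h)]

lemma inDeg_union [DecidableEq V] {A B : Finset V} (h : Disjoint A B) (v : V) :
    inDeg r (A ∪ B) v = inDeg r A v + inDeg r B v :=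
  outDeg_union (r := flip r) h v

lemma arcs_union_left [DecidableEq V] {A B : Finset V} (h : Disjoint A B) (C : Finset V) :
    arcs r (A ∪ B) C = arcs r A C + arcs r B C :=
  Finset.sum_union h

lemma arcs_union_right [DecidableEq V] {A B : Finset V} (h : Disjoint A B) (C : Finset V) :
    arcs r C (A ∪ B) = arcs r C A + arcs r C B := by
  rw [← arcs_flip, ← arcs_flip C A, ← arcs_flip C B, arcs_union_left h]

lemma arcs_singleton_left (v : V) (A : Finset V) : arcs r {v} A = outDeg r A v := by
  simp [arcs]

lemma arcs_singleton_right (v : V) (A : Finset V) : arcs r A {v} = inDeg r A v := by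
  simp [arcs_eq_sum_inDeg]

lemma outDeg_mono {A B : Finset V} (h : A ⊆ B) (v : V) : outDeg r A v ≤ outDeg r B v := by
  classical
  exact Finset.card_le_card (Finset.filter_subset_filter _ h)

lemma inDeg_mono {A B : Finset V} (h : A ⊆ B) (v : V) : inDeg r A v ≤ inDeg r B v :=
  outDeg_mono (r := flip r) h v

lemma outDeg_le_card (A : Finset V) (v : V) : outDeg r A v ≤ #A := by
  classical
  exact Finset.card_filter_le _ _

lemma arcs_le_card_mul_card (A B : Finset V) : arcs r A B ≤ #A * #B :=
  Finset.sum_le_card_nsmul _ _ _ fun v _ => outDeg_le_card B v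

namespace UniqueTwoPaths

lemma card_eq (h : UniqueTwoPaths r) (A : Finset V) (v : V) :
    #A = outDeg r A v + inDeg r A v + nonDeg r A v := by
  classical
  unfold outDeg inDeg nonDeg
  simp only [Finset.card_filter, ← Finset.sum_add_distrib]
  rw [Finset.card_eq_sum_ones]
  refine Finset.sum_congr rfl fun w _ => ?_
  have := h.asymm v w
  by_cases h1 : r v w <;> by_cases h2 : r w v <;> simp_all

lemma card_mul_card_eq (h : UniqueTwoPaths r) (A B : Finset V) :
    #A * #B = arcs r A B + arcs r B A + ∑ v ∈ A, nonDeg r B v := by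
  rw [arcs_eq_sum_inDeg r B A, arcs, ← Finset.sum_add_distrib, ← Finset.sum_add_distrib,
    ← smul_eq_mul, ← Finset.sum_const]
  exact Finset.sum_congr rfl fun v _ => h.card_eq B v

/-- For distinct middle vertices `y`, the products (in-neighbours in `A`) × (out-neighbours in `B`)
are disjoint. -/
lemma sum_inDeg_mul_outDeg_le (h : UniqueTwoPaths r) (A B Y : Finset V) :
    ∑ y ∈ Y, inDeg r A y * outDeg r B y ≤ #A * #B := by
  classical
  unfold inDeg outDeg
  simp only [← Finset.card_product]
  rw [← Finset.card_biUnion]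
  · refine Finset.card_le_card fun p hp => ?_
    simp only [Finset.mem_biUnion, Finset.mem_product, Finset.mem_filter] at hp ⊢
    tauto
  · intro y _ y' _ hne
    rw [Function.onFun, Finset.disjoint_left]
    intro p hp hp'
    simp only [Finset.mem_product, Finset.mem_filter] at hp hp'
    exact hne (h.unique p.1 y y' p.2 hp.1.2 hp'.1.2 hp.2.2 hp'.2.2)

lemma sum_inDeg_le (h : UniqueTwoPaths r) (A Y : Finset V) (w : V) (hY : ∀ y ∈ Y, r y w) :
    ∑ y ∈ Y, inDeg r A y ≤ #A := by
  classical
  have := h.sum_inDeg_mul_outDeg_le A {w} Y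
  rw [Finset.card_singleton, mul_one] at this
  refine le_trans (le_of_eq (Finset.sum_congr rfl fun y hy => ?_)) this
  have : outDeg r {w} y = 1 := by
    unfold outDeg
    rw [Finset.filter_true_of_mem (by simpa using hY y hy), Finset.card_singleton]
  rw [this, mul_one]

lemma arcs_erase [DecidableEq V] (h : UniqueTwoPaths r) {W : Finset V} {v : V} (hv : v ∈ W) :
    arcs r W W = arcs r (W.erase v) (W.erase v) + outDeg r W v + inDeg r W v := by
  have hd : Disjoint {v} (W.erase v) := by simp
  have hW : W = {v} ∪ W.erase v := by
    rw [← Finset.insert_eq, Finset.insert_erase hv]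
  have h0 : outDeg r {v} v = 0 := by
    unfold outDeg; simp [h.irrefl v]
  have h0' : inDeg r {v} v = 0 := by
    unfold inDeg; simp [h.irrefl v]
  have e1 : outDeg r W v = outDeg r (W.erase v) v := by
    conv_lhs => rw [hW, outDeg_union hd, h0, zero_add]
  have e2 : inDeg r W v = inDeg r (W.erase v) v := by
    conv_lhs => rw [hW, inDeg_union hd, h0', zero_add]
  conv_lhs => rw [hW]
  rw [arcs_union_left hd, arcs_union_right hd, arcs_union_right hd, arcs_singleton_left,
    arcs_singleton_left, arcs_singleton_right, h0, e1, e2]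
  ring

/-- A set of vertices of linear minimum degree has a cut containing all but linearly many arcs. -/
lemma exists_cut [DecidableEq V] (h : UniqueTwoPaths r) {W : Finset V} (hn : 20 ≤ #W)
    (hdeg : ∀ v ∈ W, #W ≤ 2 * (outDeg r W v + inDeg r W v) + 2) :
    ∃ S ⊆ W, arcs r W W ≤ arcs r S (W \ S) + 5 * #W := by
  classical
  set n := #W with hnW
  -- The larger of the two degrees is at least n/5, so the smaller one times n is at most five times
  -- their product; the 2-path count then bounds the sum of the smaller degrees by 5n. Every arc not
  -- going from `S` to its complement is charged to such a smaller degree.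
  let S := {v ∈ W | inDeg r W v ≤ outDeg r W v}
  have hS : S ⊆ W := Finset.filter_subset _ _
  refine ⟨S, hS, ?_⟩
  have hd : Disjoint S (W \ S) := Finset.disjoint_sdiff
  have hW : S ∪ (W \ S) = W := Finset.union_sdiff_of_subset hS
  let m : V → ℕ := fun v => min (inDeg r W v) (outDeg r W v)
  have hm : ∑ v ∈ W, m v ≤ 5 * n := by
    have h1 := h.sum_inDeg_mul_outDeg_le W W W
    have h2 : ∑ v ∈ W, m v * n ≤ ∑ v ∈ W, 5 * (inDeg r W v * outDeg r W v) := by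
      refine Finset.sum_le_sum fun v hv => ?_
      have := hdeg v hv
      simp only [m]
      rcases le_total (inDeg r W v) (outDeg r W v) with h' | h'
      · rw [min_eq_left h']
        have : n ≤ 5 * outDeg r W v := by omega
        nlinarith
      · rw [min_eq_right h']
        have : n ≤ 5 * inDeg r W v := by omega
        nlinarith
    rw [← Finset.sum_mul, ← Finset.mul_sum] at h2
    have : (∑ v ∈ W, m v) * n ≤ (5 * n) * n := by nlinarith
    exact Nat.le_of_mul_le_mul_right this (by omega)
  have h1 : arcs r S S ≤ ∑ v ∈ S, m v := by
    rw [arcs_eq_sum_inDeg]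
    refine Finset.sum_le_sum fun v hv => ?_
    have hv' := (Finset.mem_filter.1 hv).2
    simp only [m]
    rw [min_eq_left hv']
    exact inDeg_mono hS v
  have h2 : arcs r (W \ S) W ≤ ∑ v ∈ W \ S, m v := by
    refine Finset.sum_le_sum fun v hv => ?_
    have hv' : ¬ inDeg r W v ≤ outDeg r W v := fun hc => by
      rw [Finset.mem_sdiff, Finset.mem_filter] at hv
      exact hv.2 ⟨hv.1, hc⟩
    simp only [m]
    rw [min_eq_right (le_of_not_ge hv')]
  have h3 : ∑ v ∈ W, m v = ∑ v ∈ S, m v + ∑ v ∈ W \ S, m v := by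
    rw [← Finset.sum_union hd, hW]
  have h4 : arcs r W W = arcs r S W + arcs r (W \ S) W := by
    rw [← arcs_union_left hd, hW]
  have h5 : arcs r S W = arcs r S S + arcs r S (W \ S) := by
    rw [← arcs_union_right hd, hW]
  omega

end UniqueTwoPaths

end Relation

/-! ### Structure of an optimal cut -/

section Cut

variable {V : Type*} {r : V → V → Prop}

namespace UniqueTwoPaths

lemma outDeg_add_outDeg_le (h : UniqueTwoPaths r) {x y y' : V} (hne : y ≠ y') (hy : r x y)
    (hy' : r x y') (A : Finset V) : outDeg r A y + outDeg r A y' ≤ #A := by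
  classical
  unfold outDeg
  rw [← Finset.card_union_of_disjoint]
  · exact Finset.card_le_card (Finset.union_subset (Finset.filter_subset _ _)
      (Finset.filter_subset _ _))
  · rw [Finset.disjoint_filter]
    exact fun z _ h1 h2 => hne (h.unique x y y' z hy hy' h1 h2)

end UniqueTwoPaths

lemma inDeg_add_inDeg_le {A : Finset V} {y y' : V} (hA : ∀ u ∈ A, r u y → ¬ r u y') :
    inDeg r A y + inDeg r A y' ≤ #A := by
  classical
  unfold inDeg
  rw [← Finset.card_union_of_disjoint]
  · exact Finset.card_le_card (Finset.union_subset (Finset.filter_subset _ _)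
      (Finset.filter_subset _ _))
  · rw [Finset.disjoint_filter]
    exact hA

/-- A locally optimal cut `S → T` of a large dense oriented graph with unique two-paths which has
too many arcs. -/
structure Cut (r : V → V → Prop) (S T : Finset V) : Prop extends UniqueTwoPaths r where
  disj : Disjoint S T
  left_le : ∀ s ∈ S, inDeg r S s ≤ outDeg r T s
  right_le : ∀ t ∈ T, outDeg r T t ≤ inDeg r S t
  left_deg : ∀ s ∈ S,
    #S + #T ≤ 2 * (outDeg r S s + outDeg r T s + inDeg r S s + inDeg r T s) + 2
  right_deg : ∀ t ∈ T,
    #S + #T ≤ 2 * (outDeg r S t + outDeg r T t + inDeg r S t + inDeg r T t) + 2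
  few : arcs r S S + arcs r T T + arcs r T S ≤ 5 * (#S + #T)
  many : (#S + #T + 1) ^ 2 < 4 * (arcs r S T + arcs r S S + arcs r T T + arcs r T S)
  large : 10000000 ≤ #S + #T

namespace Cut

variable {S T : Finset V}

lemma flip (h : Cut r S T) : Cut (flip r) T S where
  toUniqueTwoPaths := h.toUniqueTwoPaths.flip
  disj := h.disj.symm
  left_le := h.right_le
  right_le := h.left_le
  left_deg t ht := by
    have := h.right_deg t ht
    simp only [inDeg_flip, outDeg_flip]
    omega
  right_deg t ht := by
    have := h.left_deg t ht
    simp only [inDeg_flip, outDeg_flip]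
    omega
  few := by
    have := h.few
    simp only [arcs_flip]
    omega
  many := by
    have := h.many
    simp only [arcs_flip]
    rw [add_comm #T]
    omega
  large := by
    have := h.large
    omega

lemma left_ne_right (h : Cut r S T) {s t : V} (hs : s ∈ S) (ht : t ∈ T) : s ≠ t :=
  fun e => Finset.disjoint_left.1 h.disj hs (e ▸ ht)

/-- The in-neighbourhoods of the in-neighbours of `w` are disjoint. With n = #S + #T and `R` the
in-neighbours in `T`, the degree condition and `right_le` give #R·n ≤ 2·5n + 4n + 2·#R, whence 14.
-/
lemma inDeg_right_le (h : Cut r S T) (w : V) : inDeg r T w ≤ 14 := by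
  classical
  let R := {t ∈ T | r t w}
  have hRT : R ⊆ T := Finset.filter_subset _ _
  have h1 : ∑ t ∈ R, inDeg r (S ∪ T) t ≤ #S + #T := by
    rw [← Finset.card_union_of_disjoint h.disj]
    exact h.sum_inDeg_le _ _ w fun t ht => (Finset.mem_filter.1 ht).2
  have h2 : ∑ t ∈ R, outDeg r S t ≤ arcs r T S :=
    Finset.sum_le_sum_of_subset hRT
  have h3 : ∑ t ∈ R, (#S + #T) ≤
      ∑ t ∈ R, (2 * outDeg r S t + 4 * inDeg r (S ∪ T) t + 2) := by
    refine Finset.sum_le_sum fun t ht => ?_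
    have h4 := h.right_deg t (hRT ht)
    have h5 := h.right_le t (hRT ht)
    rw [inDeg_union h.disj]
    omega
  have h4 := h.few
  have h5 := h.large
  simp only [Finset.sum_add_distrib, ← Finset.mul_sum, Finset.sum_const, smul_eq_mul] at h3 h1
  change #R ≤ 14
  by_contra hR
  have : 15 * (#S + #T - 2) ≤ #R * (#S + #T - 2) := Nat.mul_le_mul_right _ (by omega)
  have h6 : #R * (#S + #T - 2) + #R * 2 = #R * (#S + #T) := by
    rw [← mul_add]; congr 1; omega
  rw [mul_add #R #S #T] at h6
  omega

lemma outDeg_left_le (h : Cut r S T) (w : V) : outDeg r S w ≤ 14 := h.flip.inDeg_right_le w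

/-- A common in-neighbour in `S` makes the out-neighbourhoods of `s` and `t` disjoint; without one,
their in-neighbourhoods in `S` are disjoint. Local optimality turns either bound into the mixed one.
-/
lemma inDeg_add_outDeg_le (h : Cut r S T) {s t : V} (hs : s ∈ S) (ht : t ∈ T) :
    inDeg r S s + outDeg r T t ≤ max #S #T := by
  by_cases hu : ∃ u ∈ S, r u s ∧ r u t
  · obtain ⟨u, -, h1, h2⟩ := hu
    have := h.outDeg_add_outDeg_le (h.left_ne_right hs ht) h1 h2 T
    have := h.left_le s hs
    omega
  · push Not at hu
    have := inDeg_add_inDeg_le hu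
    have := h.right_le t ht
    omega

/-- Compare the pairs across the cut with `many`: the arcs inside the parts must outweigh the
nonadjacent pairs by n/2, and as they are few the parts are nearly balanced. -/
lemma nonadjacent_le (h : Cut r S T) :
    #S + #T + 2 * ∑ s ∈ S, nonDeg r T s ≤ 2 * (arcs r S S + arcs r T T) ∧
    (#S + #T) ^ 2 ≤ 4 * (#S * #T) + 20 * (#S + #T) := by
  have h1 := h.card_mul_card_eq S T
  have h2 := h.many
  have h3 := h.few
  have h4 : 4 * (#S * #T) ≤ (#S + #T) ^ 2 := by
    rw [← mul_assoc]; exact four_mul_le_sq_add _ _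
  have h5 : (#S + #T + 1) ^ 2 = (#S + #T) ^ 2 + 2 * (#S + #T) + 1 := by ring
  refine ⟨by omega, by omega⟩

/-- Nearly every arc inside `S` extends forward into all of `T`, and every arc inside `T` backward
into all of `S`; the resulting 2-paths from `S` to `T` number at most #S·#T. The last sum corrects
for nonadjacent pairs, the 14s for backward arcs. -/
lemma arcs_le_of_two_paths (h : Cut r S T) :
    #T * arcs r S S + #S * arcs r T T ≤ #S * #T + 14 * (arcs r S S + arcs r T T) +
      (∑ s ∈ S, nonDeg r T s * inDeg r S s + ∑ t ∈ T, nonDeg r S t * outDeg r T t) := by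
  classical
  have h1 := h.sum_inDeg_mul_outDeg_le S T (S ∪ T)
  rw [Finset.sum_union h.disj] at h1
  have h2 : #T * arcs r S S ≤ ∑ s ∈ S, inDeg r S s * outDeg r T s + 14 * arcs r S S +
      ∑ s ∈ S, nonDeg r T s * inDeg r S s := by
    rw [arcs_eq_sum_inDeg, Finset.mul_sum, Finset.mul_sum, ← Finset.sum_add_distrib,
      ← Finset.sum_add_distrib]
    refine Finset.sum_le_sum fun s _ => ?_
    have h3 := h.card_eq T s
    have h4 := h.inDeg_right_le s
    rw [h3]
    nlinarith [Nat.mul_le_mul_right (inDeg r S s) h4]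
  have h2' : #S * arcs r T T ≤ ∑ t ∈ T, inDeg r S t * outDeg r T t + 14 * arcs r T T +
      ∑ t ∈ T, nonDeg r S t * outDeg r T t := by
    rw [arcs, Finset.mul_sum, Finset.mul_sum, ← Finset.sum_add_distrib,
      ← Finset.sum_add_distrib]
    refine Finset.sum_le_sum fun t _ => ?_
    have h3 := h.card_eq S t
    have h4 := h.outDeg_left_le t
    rw [h3]
    nlinarith [Nat.mul_le_mul_right (outDeg r T t) h4]
  omega

/-- Sum `inDeg_add_outDeg_le` over nonadjacent pairs. At `s₀` use `left_le` instead, which gains a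
product growing with the number of vertices that `s₀` misses. -/
lemma sum_nonDeg_le (h : Cut r S T) {s₀ : V} (hs₀ : s₀ ∈ S) :
    ∑ s ∈ S, nonDeg r T s * inDeg r S s + ∑ t ∈ T, nonDeg r S t * outDeg r T t +
        (inDeg r T s₀ + nonDeg r T s₀) * nonDeg r T s₀ ≤
      max #S #T * ∑ s ∈ S, nonDeg r T s + arcs r T T := by
  classical
  rw [sum_nonDeg_comm r T S, ← Finset.sum_add_distrib]
  have hc : ∀ s ∈ S, nonDeg r T s * inDeg r S s +
      ∑ t ∈ T with ¬ r s t ∧ ¬ r t s, outDeg r T t +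
      (if s = s₀ then (inDeg r T s₀ + nonDeg r T s₀) * nonDeg r T s₀ else 0) ≤
      max #S #T * nonDeg r T s + (if s = s₀ then arcs r T T else 0) := by
    intro s hs
    by_cases e : s = s₀
    · subst e
      have h1 : ∑ t ∈ T with ¬ r s t ∧ ¬ r t s, outDeg r T t ≤ arcs r T T :=
        Finset.sum_le_sum_of_subset (Finset.filter_subset _ _)
      have h2 := h.card_eq T s
      have h3 := h.left_le s hs
      have h4 : inDeg r S s + (inDeg r T s + nonDeg r T s) ≤ max #S #T := by omega
      have h5 := Nat.mul_le_mul_right (nonDeg r T s) h4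
      simp only [if_true]
      nlinarith
    · simp only [e, if_false, add_zero]
      have h1 : ∑ t ∈ T with ¬ r s t ∧ ¬ r t s, (inDeg r S s + outDeg r T t) ≤
          ∑ t ∈ T with ¬ r s t ∧ ¬ r t s, max #S #T :=
        Finset.sum_le_sum fun t ht => h.inDeg_add_outDeg_le hs (Finset.mem_filter.1 ht).1
      rw [Finset.sum_add_distrib, Finset.sum_const, Finset.sum_const, smul_eq_mul,
        smul_eq_mul] at h1
      have h2 : #{t ∈ T | ¬ r s t ∧ ¬ r t s} = nonDeg r T s := by
        unfold nonDeg; congr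
      rw [h2] at h1
      linarith
  have := Finset.sum_le_sum hc
  rw [Finset.sum_add_distrib, Finset.sum_add_distrib (g := fun s => if s = s₀ then arcs r T T else 0),
    Finset.sum_ite_eq', Finset.sum_ite_eq',
    if_pos hs₀, if_pos hs₀, ← Finset.mul_sum] at this
  exact this

/-- Eliminating `C` and `α + β` leaves x·y of order at most (a − b)(a + b) + (a + b). Since (a − b)²
≤ 20(a + b), this is subquadratic, so x is too small to reach a tenth of a + b. -/
lemma imbalance_slack {a b α β m C x y : ℝ} (hb : 0 ≤ b) (hab : b ≤ a)
    (hn : 10000000 ≤ a + b) (hαβ : α + β ≤ 5 * (a + b))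
    (hg : a + b + 2 * m ≤ 2 * (α + β)) (hbal : (a + b) ^ 2 ≤ 4 * (a * b) + 20 * (a + b))
    (h1 : b * (α + β) ≤ a * b + 14 * (α + β) + C) (h2 : C + x * y ≤ a * m + (α + β))
    (hxy : x ≤ y + 14) : 10 * x < a + b := by
  by_contra hx
  push Not at hx
  have hd : 700 * (a - b) ≤ a + b := by
    by_contra hc
    push Not at hc
    have e1 : (a + b) * (a + b) < (700 * (a - b)) * (700 * (a - b)) :=
      mul_self_lt_mul_self (by linarith) hc
    nlinarith
  have h3 : b * (a + b) + 2 * (b * m) ≤ 2 * (b * (α + β)) := by nlinarith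
  have h4 : (a - b) * m ≤ (a - b) * (5 * (a + b)) :=
    mul_le_mul_of_nonneg_left (by linarith) (by linarith)
  have h5 : x * (x - 14) ≤ x * y := mul_le_mul_of_nonneg_left (by linarith) (by linarith)
  have h6 : (a + b) * (a + b - 140) ≤ 100 * (x * (x - 14)) := by nlinarith
  have h7 : (a - b) * b * 2 ≤ (a - b) * (a + b) := by nlinarith
  have h8 : (a - b) * (a + b) * 700 ≤ (a + b) * (a + b) := by nlinarith
  nlinarith

/-- Every vertex on the left of the cut is joined to almost all of the right. -/
lemma missing_left_lt (h : Cut r S T) {s : V} (hs : s ∈ S) :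
    10 * (inDeg r T s + nonDeg r T s) < #S + #T := by
  have h1 := h.arcs_le_of_two_paths
  have h2 := h.sum_nonDeg_le hs
  obtain ⟨h4, h5⟩ := h.nonadjacent_le
  have h6 := h.few
  have h7 := h.large
  have h8 := h.inDeg_right_le s
  generalize (∑ s ∈ S, nonDeg r T s * inDeg r S s + ∑ t ∈ T, nonDeg r S t * outDeg r T t) = C
    at h1 h2
  generalize ∑ s ∈ S, nonDeg r T s = m at *
  generalize arcs r S S = α at *
  generalize arcs r T T = β at *
  generalize nonDeg r T s = y at *
  generalize inDeg r T s = x at *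
  generalize #S = a at *
  generalize #T = b at *
  rcases le_total b a with hab | hab
  · rw [max_eq_left hab] at h2
    have h9 : b * β ≤ a * β := Nat.mul_le_mul_right _ hab
    have key := @imbalance_slack a b α β m C (x + y : ℕ) y (by positivity) (by exact_mod_cast hab)
      (by exact_mod_cast h7) (by norm_cast; omega) (by exact_mod_cast h4)
      (by exact_mod_cast h5) (by norm_cast; rw [mul_add]; omega) (by norm_cast; omega)
      (by norm_cast; omega)
    exact_mod_cast key
  · rw [max_eq_right hab] at h2
    have h9 : a * α ≤ b * α := Nat.mul_le_mul_right _ hab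
    rw [mul_comm a b] at h1 h5
    rw [add_comm a b] at *
    have key := @imbalance_slack b a α β m C (x + y : ℕ) y (by positivity) (by exact_mod_cast hab)
      (by exact_mod_cast h7) (by norm_cast; omega) (by exact_mod_cast h4)
      (by exact_mod_cast h5) (by norm_cast; rw [mul_add]; omega) (by norm_cast; omega)
      (by norm_cast; omega)
    exact_mod_cast key

lemma missing_right_lt (h : Cut r S T) {t : V} (ht : t ∈ T) :
    10 * (outDeg r S t + nonDeg r S t) < #S + #T := by
  have := h.flip.missing_left_lt ht
  rw [inDeg_flip, nonDeg_flip] at this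
  omega

end Cut

end Cut

/-! ### No such cut exists -/

section Contradiction

variable {V : Type*} {r : V → V → Prop}

lemma card_not_left (h : UniqueTwoPaths r) (A : Finset V) (v : V)
    [DecidablePred fun u => ¬ r u v] : #{u ∈ A | ¬ r u v} = outDeg r A v + nonDeg r A v := by
  classical
  have h1 := Finset.card_filter_add_card_filter_not (s := A) (fun u => r u v)
  have h2 := h.card_eq A v
  have h3 : #{u ∈ A | r u v} = inDeg r A v := by unfold inDeg; congr
  omega

lemma eq_of_outDeg_le_one {A : Finset V} {v x y : V} (h : outDeg r A v ≤ 1) (hx : x ∈ A)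
    (hy : y ∈ A) (hvx : r v x) (hvy : r v y) : x = y := by
  classical
  exact Finset.card_le_one.1 h x (Finset.mem_filter.2 ⟨hx, hvx⟩) y (Finset.mem_filter.2 ⟨hy, hvy⟩)

lemma eq_of_inDeg_le_one {A : Finset V} {v x y : V} (h : inDeg r A v ≤ 1) (hx : x ∈ A)
    (hy : y ∈ A) (hvx : r x v) (hvy : r y v) : x = y :=
  eq_of_outDeg_le_one (r := flip r) h hx hy hvx hvy

lemma exists_of_outDeg_pos {A : Finset V} {v : V} (h : 0 < outDeg r A v) : ∃ x ∈ A, r v x := by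
  classical
  obtain ⟨x, hx⟩ := Finset.card_pos.1 h
  exact ⟨x, (Finset.mem_filter.1 hx).1, (Finset.mem_filter.1 hx).2⟩

lemma nonDeg_pos {A : Finset V} {v x : V} (hx : x ∈ A) (h1 : ¬ r v x) (h2 : ¬ r x v) :
    0 < nonDeg r A v := by
  classical
  exact Finset.card_pos.2 ⟨x, Finset.mem_filter.2 ⟨hx, h1, h2⟩⟩

namespace Cut

variable {S T : Finset V}

lemma card_right_ge (h : Cut r S T) : #S + #T ≤ 4 * #T := by
  have h1 := h.nonadjacent_le.2
  have h2 := h.large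
  by_contra hc
  nlinarith

lemma outDeg_left_le_one (h : Cut r S T) (w : V) : outDeg r S w ≤ 1 := by
  classical
  refine Finset.card_le_one.2 fun s hs s' hs' => ?_
  rw [Finset.mem_filter] at hs hs'
  by_contra hne
  have h1 := h.outDeg_add_outDeg_le hne hs.2 hs'.2 T
  have h2 := h.missing_left_lt hs.1
  have h3 := h.missing_left_lt hs'.1
  have h4 := h.card_eq T s
  have h5 := h.card_eq T s'
  have h6 := h.card_right_ge
  have h7 := h.large
  omega

lemma inDeg_right_le_one (h : Cut r S T) (w : V) : inDeg r T w ≤ 1 := h.flip.outDeg_left_le_one w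

lemma arcs_left_le (h : Cut r S T) : arcs r S S ≤ #S := by
  have := Finset.sum_le_card_nsmul S (outDeg r S) 1 fun v _ => h.outDeg_left_le_one v
  simpa [arcs] using this

lemma max_add_lt (h : Cut r S T) :
    max #S #T + ∑ t ∈ T, nonDeg r S t < arcs r S S + arcs r T T := by
  have h1 := h.card_mul_card_eq T S
  have h2 := h.many
  rcases le_total #S #T with h3 | h3
  · rw [max_eq_right h3]
    by_contra hc
    nlinarith [sq_nonneg ((#S : ℤ) + 1 - #T), four_mul_le_sq_add (#S + 1) #T]
  · rw [max_eq_left h3]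
    by_contra hc
    nlinarith [four_mul_le_sq_add #S (#T + 1)]

lemma not_or_not (h : Cut r S T) {u s t v : V} (hs : s ∈ S) (ht : t ∈ T) (hus : r u s)
    (htv : r t v) : ¬ r u t ∨ ¬ r s v := by
  by_contra hc
  push Not at hc
  exact h.left_ne_right hs ht (h.unique u s t v hus hc.1 hc.2 htv)

/-- If every vertex of `U` misses some vertex of `S`, the nonadjacent pairs cancel the arcs inside
`T`. Otherwise the arcs inside `S` form almost a star into some `x` that misses nearly all of `U`;
equality is then forced almost everywhere, and following arcs out of `x` gives a contradiction. -/
lemma not_right_heavy (h : Cut r S T) : ¬ arcs r T T ≤ arcs r S S := by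
  classical
  intro hle
  have hmax := h.max_add_lt
  have hlarge := h.large
  have hSle := h.arcs_left_le
  set U := {v ∈ T | 0 < inDeg r T v} with hU
  have hUT : U ⊆ T := Finset.filter_subset _ _
  have hmemU : ∀ t ∈ T, ∀ v ∈ T, r t v → v ∈ U := fun t ht v hv htv =>
    Finset.mem_filter.2 ⟨hv, Finset.card_pos.2 ⟨t, Finset.mem_filter.2 ⟨ht, htv⟩⟩⟩
  have hexU : ∀ v ∈ U, ∃ t ∈ T, r t v := fun v hv =>
    exists_of_outDeg_pos (r := _root_.flip r) (Finset.mem_filter.1 hv).2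
  have hcardU : arcs r T T ≤ #U := by
    rw [arcs_eq_sum_inDeg, hU, Finset.card_filter]
    refine Finset.sum_le_sum fun v _ => ?_
    have := h.inDeg_right_le_one v
    split_ifs <;> omega
  set D := {u ∈ S | 0 < outDeg r S u} with hD
  have hcardD : arcs r S S ≤ #D := by
    rw [arcs, hD, Finset.card_filter]
    refine Finset.sum_le_sum fun v _ => ?_
    have := h.outDeg_left_le_one v
    split_ifs <;> omega
  have hbad : ∀ t ∈ T, 10 * #{u ∈ S | ¬ r u t} < #S + #T := fun t ht => by
    rw [card_not_left h.toUniqueTwoPaths]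
    exact h.missing_right_lt ht
  have hD4 : #S + #T ≤ 4 * #D := by omega
  by_cases hall : ∀ v ∈ U, 0 < nonDeg r S v
  · have h1 : #U ≤ ∑ t ∈ T, nonDeg r S t := by
      rw [Finset.card_eq_sum_ones]
      exact (Finset.sum_le_sum fun v hv => hall v hv).trans (Finset.sum_le_sum_of_subset hUT)
    omega
  push Not at hall
  obtain ⟨v₀, hv₀U, hv₀⟩ := hall
  have hv₀T := hUT hv₀U
  have hv₀adj : ∀ s ∈ S, ¬ r s v₀ → r v₀ s := fun s hs hns => by
    by_contra hc
    have := nonDeg_pos hs hc hns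
    omega
  obtain ⟨t₁, ht₁, htv₁⟩ := hexU v₀ hv₀U
  have hgood : ∀ u ∈ D, r u t₁ → ∃ s ∈ S, r u s ∧ r v₀ s := fun u hu hut => by
    obtain ⟨s, hs, hus⟩ := exists_of_outDeg_pos (Finset.mem_filter.1 hu).2
    refine ⟨s, hs, hus, hv₀adj s hs ?_⟩
    exact (h.not_or_not hs ht₁ hus htv₁).resolve_left (not_not.2 hut)
  have hcount : #D ≤ #{u ∈ D | r u t₁} + #{u ∈ S | ¬ r u t₁} := by
    rw [← Finset.card_filter_add_card_filter_not (s := D) (fun u => r u t₁)]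
    exact Nat.add_le_add_left
      (Finset.card_le_card (Finset.filter_subset_filter _ (Finset.filter_subset _ _))) _
  have hbad₁ := hbad t₁ ht₁
  obtain ⟨u, hu⟩ : {u ∈ D | r u t₁}.Nonempty := Finset.card_pos.1 (by omega)
  obtain ⟨x, hx, -, hv₀x⟩ := hgood u (Finset.mem_filter.1 hu).1 (Finset.mem_filter.1 hu).2
  have huniq : ∀ s ∈ S, r v₀ s → s = x := fun s hs hvs =>
    eq_of_outDeg_le_one (h.outDeg_left_le_one v₀) hs hx hvs hv₀x
  -- `v₀` has only one out-neighbour in `S`, so all these `u` have the same successor `x`.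
  have hstar : #{u ∈ D | r u t₁} ≤ inDeg r S x := by
    refine Finset.card_le_card fun u hu => ?_
    obtain ⟨hu1, hu2⟩ := Finset.mem_filter.1 hu
    obtain ⟨s, hs, hus, hvs⟩ := hgood u hu1 hu2
    exact Finset.mem_filter.2 ⟨(Finset.mem_filter.1 hu1).1, huniq s hs hvs ▸ hus⟩
  have hxmiss : ∀ t ∈ T, ∀ v, r t v → ¬ r x v := fun t ht v htv => by
    have hex : ∃ u ∈ S, r u x ∧ r u t := by
      by_contra hc
      push Not at hc
      have h1 := inDeg_add_inDeg_le hc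
      have h2 := h.card_eq S t
      have h3 := h.missing_right_lt ht
      omega
    obtain ⟨u, -, hux, hut⟩ := hex
    exact (h.not_or_not hx ht hux htv).resolve_left (not_not.2 hut)
  have hTx : ∀ t ∈ T, r t x → t = v₀ := fun t ht htx =>
    eq_of_inDeg_le_one (h.inDeg_right_le_one x) ht hv₀T htx hv₀x
  have hnonU : ∀ v ∈ U, v ≠ v₀ → ¬ r v x ∧ ¬ r x v := fun v hv hne => by
    obtain ⟨t, ht, htv⟩ := hexU v hv
    exact ⟨fun hc => hne (hTx v (hUT hv) hc), hxmiss t ht v htv⟩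
  have hcardErase : #(U.erase v₀) + 1 = #U := Finset.card_erase_add_one hv₀U
  have hge : ∀ v ∈ T, (if v ∈ U.erase v₀ then 1 else 0) ≤ nonDeg r S v := fun v _ => by
    split_ifs with hv
    · rw [Finset.mem_erase] at hv
      exact nonDeg_pos hx (hnonU v hv.2 hv.1).1 (hnonU v hv.2 hv.1).2
    · exact Nat.zero_le _
  have hsumErase : ∑ v ∈ T, (if v ∈ U.erase v₀ then 1 else 0) = #(U.erase v₀) := by
    rw [← Finset.card_filter, Finset.filter_mem_eq_inter,
      Finset.inter_eq_right.2 ((Finset.erase_subset _ _).trans hUT)]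
  have hsumge := Finset.sum_le_sum hge
  -- The missing pairs at `x` number #U − 1, leaving a slack of one in `max_add_lt`, which is an
  -- integer strict inequality; so every estimate is tight.
  have hfull : arcs r S S = #S := by omega
  have honly : ∀ s ∈ S, ∀ v ∈ T, ¬ r s v → ¬ r v s → s = x ∧ v ∈ U := by
    intro s hs v hv hsv hvs
    by_contra hc
    have hge' : ∀ w ∈ T, (if w ∈ U.erase v₀ then 1 else 0) + (if w = v then 1 else 0) ≤
        nonDeg r S w := by
      intro w hw
      by_cases hwv : w = v
      · subst hwv
        by_cases hwU : w ∈ U.erase v₀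
        · rw [if_pos hwU, if_pos rfl]
          rw [Finset.mem_erase] at hwU
          have hsx : s ≠ x := fun e => hc ⟨e, hwU.2⟩
          have hsub : ({s, x} : Finset V) ⊆ {u ∈ S | ¬ r w u ∧ ¬ r u w} := by
            intro y hy
            rw [Finset.mem_insert, Finset.mem_singleton] at hy
            rcases hy with rfl | rfl
            · exact Finset.mem_filter.2 ⟨hs, hvs, hsv⟩
            · exact Finset.mem_filter.2 ⟨hx, hnonU w hwU.2 hwU.1⟩
          have := Finset.card_le_card hsub
          rw [Finset.card_pair hsx] at this
          unfold nonDeg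
          convert this
        · rw [if_neg hwU, if_pos rfl, zero_add]
          exact nonDeg_pos hs hvs hsv
      · rw [if_neg hwv, add_zero]
        exact hge w hw
    have hs1 := Finset.sum_le_sum hge'
    rw [Finset.sum_add_distrib, hsumErase, Finset.sum_ite_eq', if_pos hv] at hs1
    omega
  have hout : ∀ u ∈ S, ∃ s ∈ S, r u s := by
    intro u hu
    refine exists_of_outDeg_pos (Nat.pos_of_ne_zero fun h0 => ?_)
    have hlt : ∑ v ∈ S, outDeg r S v < ∑ v ∈ S, 1 :=
      Finset.sum_lt_sum (fun v _ => h.outDeg_left_le_one v) ⟨u, hu, by omega⟩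
    rw [← Finset.card_eq_sum_ones] at hlt
    exact absurd hfull (by unfold arcs; omega)
  obtain ⟨y, hy, hxy⟩ := hout x hx
  obtain ⟨z, hz, hyz⟩ := hout y hy
  have hyx : y ≠ x := fun e => h.irrefl x (by rwa [e] at hxy)
  have hzx : z ≠ x := fun e => h.asymm x y hxy (e ▸ hyz)
  have hzy : z ≠ y := fun e => h.irrefl y (by rwa [e] at hyz)
  have hback : ∀ s ∈ S, s ≠ x → ∀ v ∈ T, ¬ r s v → r v s := fun s hs hsx v hv hns => by
    by_contra hc
    exact hsx (honly s hs v hv hns hc).1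
  have hyt₁ : r t₁ y := by
    rcases h.not_or_not hz ht₁ hyz htv₁ with h1 | h1
    · exact hback y hy hyx t₁ ht₁ h1
    · exact absurd (huniq z hz (hv₀adj z hz h1)) hzx
  have hxt₁ : ¬ r x t₁ := by
    rcases h.not_or_not hy ht₁ hxy htv₁ with h1 | h1
    · exact h1
    · exact absurd (huniq y hy (hv₀adj y hy h1)) hyx
  have ht₁x : ¬ r t₁ x := fun hc => by
    rw [hTx t₁ ht₁ hc] at htv₁
    exact h.irrefl v₀ htv₁
  obtain ⟨t₂, ht₂, htt⟩ := hexU t₁ (honly x hx t₁ ht₁ hxt₁ ht₁x).2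
  rcases h.not_or_not hz ht₂ hyz htt with h1 | h1
  · have h2 := eq_of_inDeg_le_one (h.inDeg_right_le_one y) ht₂ ht₁ (hback y hy hyx t₂ ht₂ h1) hyt₁
    rw [h2] at htt
    exact h.irrefl t₁ htt
  · exact hzy (eq_of_outDeg_le_one (h.outDeg_left_le_one t₁) hz hy (hback z hz hzx t₁ ht₁ h1) hyt₁)

theorem elim (h : Cut r S T) : False := by
  rcases le_total (arcs r T T) (arcs r S S) with h1 | h1
  · exact h.not_right_heavy h1
  · exact h.flip.not_right_heavy (by rwa [arcs_flip, arcs_flip])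

end Cut

end Contradiction

/-! ### Reduction to large minimum degree -/

section UpperBound

variable {V : Type*} {r : V → V → Prop}

/-- A large set of vertices of almost balanced minimum degree spans at most `⌊(n + 1)² / 4⌋`
arcs. -/
lemma UniqueTwoPaths.four_mul_arcs_le (h : UniqueTwoPaths r) {W : Finset V}
    (hn : 10000000 ≤ #W)
    (hdeg : ∀ v ∈ W, #W ≤ 2 * (outDeg r W v + inDeg r W v) + 2) :
    4 * arcs r W W ≤ (#W + 1) ^ 2 := by
  classical
  by_contra hlt
  push Not at hlt
  obtain ⟨S₀, hS₀, hcut⟩ := h.exists_cut (by omega) hdeg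
  -- A maximum cut inherits the bound of `S₀`, and moving one vertex across it yields `left_le` and
  -- `right_le`.
  obtain ⟨S, hS, hmax⟩ := Finset.exists_max_image W.powerset (fun S => arcs r S (W \ S))
    ⟨W, Finset.mem_powerset_self W⟩
  rw [Finset.mem_powerset] at hS
  have hd : Disjoint S (W \ S) := Finset.disjoint_sdiff
  have hW : S ∪ (W \ S) = W := Finset.union_sdiff_of_subset hS
  have hcard : #S + #(W \ S) = #W := by rw [← Finset.card_union_of_disjoint hd, hW]
  have htot : arcs r W W = arcs r S S + arcs r S (W \ S) + (arcs r (W \ S) S +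
      arcs r (W \ S) (W \ S)) := by
    conv_lhs => rw [← hW]
    rw [arcs_union_left hd, arcs_union_right hd, arcs_union_right hd]
  have hmax₀ := hmax S₀ (Finset.mem_powerset.2 hS₀)
  have hout : ∀ v, outDeg r W v = outDeg r S v + outDeg r (W \ S) v := fun v => by
    rw [← outDeg_union hd, hW]
  have hin : ∀ v, inDeg r W v = inDeg r S v + inDeg r (W \ S) v := fun v => by
    rw [← inDeg_union hd, hW]
  have hout0 : ∀ v, outDeg r {v} v = 0 := fun v => by unfold outDeg; simp [h.irrefl v]
  have hin0 : ∀ v, inDeg r {v} v = 0 := fun v => by unfold inDeg; simp [h.irrefl v]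
  refine Cut.elim (r := r) (S := S) (T := W \ S) ⟨h, hd, ?_, ?_, ?_, ?_, ?_, ?_, ?_⟩
  · intro s hs
    have hm := hmax (S.erase s) (Finset.mem_powerset.2 ((Finset.erase_subset _ _).trans hS))
    have e1 : W \ S.erase s = {s} ∪ W \ S := by
      ext w; by_cases hw : w = s <;> simp_all [hS hs]
    have d1 : Disjoint {s} (W \ S) := by simp [hs]
    have d2 : Disjoint {s} (S.erase s) := by simp
    have e2 : S = {s} ∪ S.erase s := by rw [← Finset.insert_eq, Finset.insert_erase hs]
    have e3 : arcs r S (W \ S) = outDeg r (W \ S) s + arcs r (S.erase s) (W \ S) := by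
      conv_lhs => rw [e2, arcs_union_left d2, arcs_singleton_left, ← e2]
    have e4 : inDeg r S s = inDeg r (S.erase s) s := by
      conv_lhs => rw [e2, inDeg_union d2, hin0, zero_add]
    simp only [e1] at hm
    rw [arcs_union_right d1, arcs_singleton_right, e3] at hm
    omega
  · intro t ht
    have htW := (Finset.mem_sdiff.1 ht).1
    have htS := (Finset.mem_sdiff.1 ht).2
    have hm := hmax ({t} ∪ S) (Finset.mem_powerset.2
      (Finset.union_subset (Finset.singleton_subset_iff.2 htW) hS))
    have d1 : Disjoint {t} S := by simp [htS]
    have e1 : W \ ({t} ∪ S) = (W \ S).erase t := by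
      ext w; simp only [Finset.mem_sdiff, Finset.mem_union, Finset.mem_singleton,
        Finset.mem_erase]; tauto
    have d2 : Disjoint {t} ((W \ S).erase t) := by simp
    have e2 : W \ S = {t} ∪ (W \ S).erase t := by
      rw [← Finset.insert_eq, Finset.insert_erase ht]
    have e3 : arcs r S (W \ S) = inDeg r S t + arcs r S ((W \ S).erase t) := by
      conv_lhs => rw [e2, arcs_union_right d2, arcs_singleton_right]
    have e4 : outDeg r (W \ S) t = outDeg r ((W \ S).erase t) t := by
      conv_lhs => rw [e2, outDeg_union d2, hout0, zero_add]
    simp only [e1] at hm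
    rw [arcs_union_left d1, arcs_singleton_left, e3] at hm
    omega
  · intro s hs
    have := hdeg s (hS hs)
    rw [hout, hin] at this
    omega
  · intro t ht
    have := hdeg t (Finset.mem_sdiff.1 ht).1
    rw [hout, hin] at this
    omega
  · omega
  · rw [hcard]
    omega
  · omega

lemma sq_div_four_add_succ (m : ℕ) :
    (m + 1) ^ 2 / 4 + (m + 1 + 1) / 2 = m ^ 2 / 4 + (m + 1) / 2 + (m + 2) / 2 := by
  obtain ⟨k, rfl | rfl⟩ := m.even_or_odd'
  · have e1 : (2 * k + 1) ^ 2 = 4 * (k ^ 2 + k) + 1 := by ring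
    have e2 : (2 * k) ^ 2 = 4 * k ^ 2 := by ring
    omega
  · have e1 : (2 * k + 1) ^ 2 = 4 * (k ^ 2 + k) + 1 := by ring
    have e2 : (2 * k + 1 + 1) ^ 2 = 4 * (k ^ 2 + 2 * k + 1) := by ring
    omega

lemma succ_sq_lt_of_lt {m e : ℕ} (h : m ^ 2 / 4 + (m + 1) / 2 < e) : (m + 1) ^ 2 < 4 * e := by
  obtain ⟨k, rfl | rfl⟩ := m.even_or_odd'
  · have e1 : (2 * k + 1) ^ 2 = 4 * (k ^ 2 + k) + 1 := by ring
    have e2 : (2 * k) ^ 2 = 4 * k ^ 2 := by ring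
    omega
  · have e1 : (2 * k + 1) ^ 2 = 4 * (k ^ 2 + k) + 1 := by ring
    have e2 : (2 * k + 1 + 1) ^ 2 = 4 * (k ^ 2 + 2 * k + 1) := by ring
    omega

lemma UniqueTwoPaths.arcs_univ_le [Fintype V] (h : UniqueTwoPaths r)
    (hn : 200000000000000 ≤ Fintype.card V) :
    arcs r univ univ ≤ Fintype.card V ^ 2 / 4 + (Fintype.card V + 1) / 2 := by
  classical
  by_contra hlt
  push Not at hlt
  let f : ℕ → ℕ := fun m => m ^ 2 / 4 + (m + 1) / 2
  -- The term `#W` forces a maximiser `W` to be large: a small one would need an excess of about n >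
  -- 10¹⁴ ≥ #W² arcs. It costs only one in the minimum degree obtained by deleting a vertex.
  obtain ⟨W, -, hW⟩ := Finset.exists_max_image (univ : Finset (Finset V))
    (fun W => (arcs r W W : ℤ) - f #W + #W) ⟨univ, Finset.mem_univ _⟩
  have hVW := hW univ (Finset.mem_univ _)
  simp only [Finset.card_univ] at hVW
  have hfV : f (Fintype.card V) < arcs r univ univ := hlt
  have hWV : #W ≤ Fintype.card V := Finset.card_le_univ W
  have hWW := arcs_le_card_mul_card (r := r) W W
  have hlarge : 10000000 ≤ #W := by
    by_contra hc
    have : #W * #W ≤ 10000000 * 10000000 := Nat.mul_le_mul (by omega) (by omega)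
    omega
  have h1 := succ_sq_lt_of_lt (m := #W) (e := arcs r W W) (show f #W < _ by omega)
  have h2 := h.four_mul_arcs_le hlarge fun v hv => by
    have h3 := hW (W.erase v) (Finset.mem_univ _)
    have h4 := h.arcs_erase hv
    obtain ⟨m, hm⟩ : ∃ m, #W = m + 1 := ⟨#W - 1, by omega⟩
    have h5 : f #W = f m + (m + 2) / 2 := by rw [hm]; exact sq_div_four_add_succ m
    rw [Finset.card_erase_of_mem hv, hm, Nat.add_sub_cancel, ← hm] at h3
    omega
  omega

end UpperBound

/-! ### Translation to digraphs and the extremal construction -/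

section Digraph

lemma uniqueTwoPaths_of_free {V : Type*} {G : Digraph V} (h : IsOriented G)
    (hF : Free G orientedC4) : UniqueTwoPaths G.Adj := by
  refine ⟨h, fun x y y' z h1 h2 h3 h4 => ?_⟩
  by_contra hne
  have hirr : ∀ v, ¬ G.Adj v v := fun v hv => h v v hv hv
  have ne : ∀ {u v}, G.Adj u v → u ≠ v := fun {u v} huv e => hirr v (e ▸ huv)
  have hxz : x ≠ z := fun e => h x y h1 (e ▸ h3)
  refine hF ⟨![x, y, y', z], ?_, ?_⟩
  · intro i j hij
    have a1 := ne h1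
    have a2 := ne h2
    have a3 := ne h3
    have a4 := ne h4
    fin_cases i <;> fin_cases j <;> simp_all [eq_comm]
  · rintro a b (⟨rfl, rfl⟩ | ⟨rfl, rfl⟩ | ⟨rfl, rfl⟩ | ⟨rfl, rfl⟩) <;> simpa

lemma free_of_uniqueTwoPaths {V : Type*} {G : Digraph V} (h : UniqueTwoPaths G.Adj) :
    Free G orientedC4 := by
  rintro ⟨φ, hφ, hG⟩
  have := h.unique (φ 0) (φ 1) (φ 2) (φ 3) (hG _ _ (by simp [orientedC4]))
    (hG _ _ (by simp [orientedC4])) (hG _ _ (by simp [orientedC4])) (hG _ _ (by simp [orientedC4]))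
  exact absurd (hφ this) (by decide)

lemma arcCount_eq_arcs {V : Type*} [Fintype V] (G : Digraph V) :
    arcCount G = arcs G.Adj univ univ := by
  classical
  have : {p : V × V | G.Adj p.1 p.2} =
      (((univ : Finset V) ×ˢ univ).filter fun p => G.Adj p.1 p.2 : Finset (V × V)) := by
    ext p; simp
  rw [arcCount, this, Set.ncard_coe_finset, Finset.card_filter, Finset.sum_product]
  simp only [arcs, outDeg, Finset.card_filter]

/-- The arcs from `A` to its complement together with those of a permutation of `A`. -/
def JoinPerm {V : Type*} (A : Finset V) (σ : Equiv.Perm V) (u v : V) : Prop :=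
  (u ∈ A ∧ v ∉ A) ∨ (u ∈ A ∧ v = σ u)

section JoinPerm

variable {V : Type*} [Fintype V] [DecidableEq V] {A : Finset V} {σ : Equiv.Perm V}

/-- Vertices outside `A` have no out-arcs, so the middle of a 2-path from `x` is `σ x`. Length at
least 3 excludes a pair of opposite arcs. -/
lemma uniqueTwoPaths_joinPerm (hσ : σ.IsCycle) (hA : σ.support = A) (hc : 3 ≤ #A) :
    UniqueTwoPaths (JoinPerm A σ) := by
  have hmem : ∀ u, u ∈ A → σ u ∈ A := fun u hu => by
    rw [← hA] at hu ⊢; exact Equiv.Perm.apply_mem_support.2 hu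
  refine ⟨?_, ?_⟩
  · rintro u v (⟨hu, hv⟩ | ⟨hu, rfl⟩)
    · rintro (⟨hv', -⟩ | ⟨hv', -⟩) <;> exact hv hv'
    · rintro (⟨-, hv'⟩ | ⟨-, hv'⟩)
      · exact hv' hu
      · have h2 : (σ ^ 2) u = u := by rw [sq, Equiv.Perm.mul_apply, ← hv']
        have h3 : σ ^ 2 = 1 := by
          rw [hσ.pow_eq_one_iff]
          refine ⟨u, ?_, h2⟩
          rw [← hA] at hu
          exact Equiv.Perm.mem_support.1 hu
        have h4 := orderOf_dvd_of_pow_eq_one h3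
        rw [hσ.orderOf, hA] at h4
        exact absurd (Nat.le_of_dvd (by norm_num) h4) (by omega)
  · have key : ∀ x y z, JoinPerm A σ x y → JoinPerm A σ y z → y = σ x := by
      rintro x y z (⟨-, hy⟩ | ⟨-, hy⟩) hyz
      · rcases hyz with ⟨h, -⟩ | ⟨h, -⟩ <;> exact absurd h hy
      · exact hy
    intro x y y' z h1 h2 h3 h4
    rw [key x y z h1 h3, key x y' z h2 h4]

lemma arcs_joinPerm (hA : σ.support = A) :
    arcs (JoinPerm A σ) univ univ = #A * (Fintype.card V - #A) + #A := by
  classical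
  have hmem : ∀ u, u ∈ A → σ u ∈ A := fun u hu => by
    rw [← hA] at hu ⊢; exact Equiv.Perm.apply_mem_support.2 hu
  have h : ∀ u, outDeg (JoinPerm A σ) univ u =
      if u ∈ A then Fintype.card V - #A + 1 else 0 := by
    intro u
    unfold outDeg JoinPerm
    split_ifs with hu
    · rw [← Finset.card_compl, ← Finset.card_insert_of_notMem (a := σ u) (by simpa using hmem u hu)]
      congr 1
      · ext w
        simp only [Finset.mem_filter, Finset.mem_univ, true_and, hu, Finset.mem_insert,
          Finset.mem_compl]
        tauto
    · simp [hu]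
  simp only [arcs, h]
  rw [← Finset.sum_filter, Finset.sum_const, Finset.filter_mem_eq_inter, Finset.univ_inter,
    smul_eq_mul]
  ring

end JoinPerm

lemma half_mul_half_add (n : ℕ) :
    (n + 1) / 2 * (n - (n + 1) / 2) + (n + 1) / 2 = n ^ 2 / 4 + (n + 1) / 2 := by
  obtain ⟨k, rfl | rfl⟩ := n.even_or_odd'
  · have e1 : (2 * k + 1) / 2 = k := by omega
    have e2 : 2 * k - k = k := by omega
    have e3 : (2 * k) ^ 2 = 4 * (k * k) := by ring
    rw [e1, e2]
    omega
  · have e1 : (2 * k + 1 + 1) / 2 = k + 1 := by omega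
    have e2 : 2 * k + 1 - (k + 1) = k := by omega
    have e3 : (2 * k + 1) ^ 2 = 4 * ((k + 1) * k) + 1 := by ring
    rw [e1, e2]
    omega

lemma IsBipartiteWithCycle.spec {n : ℕ} (hn : 5 ≤ n) {G : Digraph (Fin n)}
    (h : IsBipartiteWithCycle G) :
    IsOriented G ∧ Free G orientedC4 ∧ arcCount G = n ^ 2 / 4 + (n + 1) / 2 := by
  obtain ⟨A, σ, hcard, hσ, hA, hG⟩ := h
  have hcount := arcs_joinPerm hA
  rw [Fintype.card_fin, hcard, half_mul_half_add] at hcount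
  rcases hG with hG | hG
  · have hr : G.Adj = JoinPerm A σ := by
      ext u v; exact hG u v
    have hu := uniqueTwoPaths_joinPerm hσ hA (by omega)
    refine ⟨fun u v => ?_, free_of_uniqueTwoPaths (by rwa [hr]), ?_⟩
    · rw [hr]; exact hu.asymm u v
    · rw [arcCount_eq_arcs, hr, hcount]
  -- Reversing all arcs reduces to the first orientation with the inverse cycle.
  · have hA' : (σ⁻¹).support = A := by rw [Equiv.Perm.support_inv, hA]
    have hr : G.Adj = flip (JoinPerm A σ⁻¹) := by
      ext u v
      rw [hG, flip, JoinPerm]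
      have : (u ∈ A ∧ v = σ u) ↔ (v ∈ A ∧ u = σ⁻¹ v) := by
        rw [Equiv.Perm.eq_inv_iff_eq]
        constructor
        · rintro ⟨hu, rfl⟩
          rw [← hA] at hu ⊢
          exact ⟨Equiv.Perm.apply_mem_support.2 hu, rfl⟩
        · rintro ⟨hv, rfl⟩
          rw [← hA] at hv ⊢
          exact ⟨Equiv.Perm.apply_mem_support.1 hv, rfl⟩
      tauto
    have hu := (uniqueTwoPaths_joinPerm hσ.inv hA' (by omega)).flip
    have hcount' := arcs_joinPerm hA'
    rw [Fintype.card_fin, hcard, half_mul_half_add] at hcount'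
    refine ⟨fun u v => ?_, free_of_uniqueTwoPaths (by rwa [hr]), ?_⟩
    · rw [hr]; exact hu.asymm u v
    · rw [arcCount_eq_arcs, hr, arcs_flip, hcount']

lemma exists_isBipartiteWithCycle {n : ℕ} (hn : 3 ≤ n) :
    ∃ G : Digraph (Fin n), IsBipartiteWithCycle G := by
  obtain ⟨A, -, hA⟩ := Finset.exists_subset_card_eq (s := (univ : Finset (Fin n)))
    (n := (n + 1) / 2) (by rw [Finset.card_univ, Fintype.card_fin]; omega)
  have hlen : 2 ≤ A.toList.length := by rw [Finset.length_toList]; omega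
  have hsupp : A.toList.formPerm.support = A := by
    rw [List.support_formPerm_of_nodup _ A.nodup_toList, Finset.toList_toFinset]
    intro x hx
    rw [hx] at hlen
    simp at hlen
  exact ⟨⟨JoinPerm A A.toList.formPerm⟩, A, A.toList.formPerm, hA,
    List.isCycle_formPerm A.nodup_toList hlen, hsupp, Or.inl fun u v => Iff.rfl⟩

end Digraph

end OrientedTuran

/-- For all sufficiently large `n`, the oriented Turán number of the `C₄` with arcs
`x → y₁ → z`, `x → y₂ → z` is `⌊n²/4⌋ + ⌈n/2⌉` (division below is that of natural numbers), and it
is attained by the antidirected balanced complete bipartite graph with a directed cycle added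
inside the larger part. -/
theorem theorem3p2 :
    ∃ N : ℕ, ∀ n : ℕ, N ≤ n →
      OrientedTuran.exo n OrientedTuran.orientedC4 = n ^ 2 / 4 + (n + 1) / 2 ∧
      (∃ G : Digraph (Fin n), OrientedTuran.IsBipartiteWithCycle G) ∧
      (∀ G : Digraph (Fin n), OrientedTuran.IsBipartiteWithCycle G →
        OrientedTuran.IsOriented G ∧
        OrientedTuran.Free G OrientedTuran.orientedC4 ∧
        OrientedTuran.arcCount G = n ^ 2 / 4 + (n + 1) / 2) := by
  classical
  refine ⟨200000000000000, fun n hn => ?_⟩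
  have hspec : ∀ G : Digraph (Fin n), OrientedTuran.IsBipartiteWithCycle G →
      OrientedTuran.IsOriented G ∧ OrientedTuran.Free G OrientedTuran.orientedC4 ∧
      OrientedTuran.arcCount G = n ^ 2 / 4 + (n + 1) / 2 :=
    fun G hG => hG.spec (by omega)
  have hex := OrientedTuran.exists_isBipartiteWithCycle (n := n) (by omega)
  refine ⟨le_antisymm ?_ ?_, hex, hspec⟩
  · refine Finset.sup_le fun G hG => ?_
    obtain ⟨-, hO, hF⟩ := Finset.mem_filter.1 hG
    have := (OrientedTuran.uniqueTwoPaths_of_free hO hF).arcs_univ_le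
      (by rwa [Fintype.card_fin])
    rwa [Fintype.card_fin, ← OrientedTuran.arcCount_eq_arcs] at this
  · obtain ⟨G, hG⟩ := hex
    obtain ⟨hO, hF, hc⟩ := hspec G hG
    rw [← hc]
    exact Finset.le_sup (f := OrientedTuran.arcCount)
      (Finset.mem_filter.2 ⟨Finset.mem_univ _, hO, hF⟩)
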